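/- Fix a modal signature consisting of finitely many binary relation symbols $E_i$ (one per agent $i$) and finitely many unary relation symbols $P_j$ (one per basic proposition $j$). A pointed Kripke structure $\mathfrak{M},w$ is a structure $\mathfrak{M}=(W,(E_i),(P_j))$ over this signature together with a world $w\in W$; write $E_i[u]=\{v\in W : (u,v)\in E_i\}$. A non-empty relation $Z\subseteq W\times W'$ is a graded bisimulation between $\mathfrak{M}$ and $\mathfrak{M}'$ if for all $(u,u')\in Z$: (atoms) $u\in P_j\Leftrightarrow u'\in P_j'$ for all $j$; (forth) for all $i$, all $k\ge 1$ and all pairwise distinct $v_1,\dots,v_k\in E_i[u]$ there are pairwise distinct $v_1',\dots,v_k'\in E_i'[u']$ with $(v_t,v_t')\in Z$ for all $t$; (back) symmetrically. $\mathfrak{M},w$ and $\mathfrak{M}',w'$ are graded bisimilar if some graded bisimulation contains $(w,w')$. For $c,\ell\in\mathbb{N}$, the $c$-graded $\ell$-round game is played by players I and II. In a position $(u,u')\in W\times W'$, player I picks some $i$ and a non-empty set of size at most $c$ contained in $E_i[u]$ or in $E_i'[u']$; player II responds with a set of the same size contained in $E_i'[u']$ or $E_i[u]$, respectively, on the opposite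 side; I picks a world in the set proposed by II, and II picks a world in the set proposed by I; these two worlds form the next position. A player who cannot move loses, and II loses as soon as the two worlds of a position (including the initial one) disagree on some $P_j$. $\mathfrak{M},w$ and $\mathfrak{M}',w'$ are $c$-graded $\ell$-bisimilar if II has a winning strategy in the $\ell$-round game from $(w,w')$. A first-order formula $\varphi(x)$ (with equality, over this signature, in a single free variable) is invariant under a relation between pointed Kripke structures over a class of these if related members of the class agree on the truth of $\varphi$. **Upgrading lemma.** (1) Let $\varphi(x)$ be a first-order formula of quantifier rank $q$ and put $\ell=2^q-1$. If $\varphi$ is invariant under graded bisimilarity over the class of all pointed Kripke structures, then for some $c\in\mathbb{N}$ it is invariant under $c$-graded $\ell$-bisimilarity over the class of all pointed Kripke structures. Likewise, if $\varphi$ is invariant under graded bisimilarity over the class of all finite pointed Kripke structures, then for some $c\in\mathbb{N}$ it is invariant under $c$-graded $\ell$-bisimilarity over the class of all finite pointed Kripke structures. (2) The value $\ell=2^q-1$ is optimal: if there is at least one agent, then for every $q\in\mathbb{N}$ there is a first-order formula $\varphi(x)$ of quantifier rank $q$ that is invariant under graded bisimilarity over the class of all pointed Kripke structures, and that is not invariant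 under $c$-graded $\ell$-bisimilarity over this class for any $c\in\mathbb{N}$ and any $\ell<2^q-1$. The same holds with the class of all finite pointed Kripke structures in place of the class of all pointed Kripke structures. -/

import Mathlib

universe u v w

namespace GradedModal

/-- A Kripke structure on the set `W` of worlds, for agents indexed by `ι` and basic propositions
indexed by `κ`. -/
structure KripkeStructure (ι : Type v) (κ : Type w) (W : Type u) where
  /-- the accessibility relations -/
  E : ι → W → W → Prop
  /-- the extensions of the basic propositions -/
  P : κ → W → Prop

/-- A pointed Kripke structure: a Kripke structure with a distinguished world
(in particular, the set of worlds is non-empty). -/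
structure PointedKripke (ι : Type v) (κ : Type w) where
  /-- the set of worlds -/
  World : Type u
  /-- the Kripke structure -/
  str : KripkeStructure ι κ World
  /-- the distinguished world -/
  point : World

section FirstOrderLogic

/-- Relation symbols of the first-order counterpart of a modal signature: a unary symbol for each
basic proposition and a binary symbol for each agent. -/
inductive ModalRel (ι : Type v) (κ : Type w) : ℕ → Type (max v w)
  | pred (j : κ) : ModalRel ι κ 1
  | acc (i : ι) : ModalRel ι κ 2

/-- The relational first-order language of a modal signature. -/
def modalLang (ι : Type v) (κ : Type w) : FirstOrder.Language.{0, max v w} :=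
  ⟨fun _ => Empty, ModalRel ι κ⟩

/-- A Kripke structure as a first-order structure. -/
@[reducible]
def KripkeStructure.toFO {ι : Type v} {κ : Type w} {W : Type u} (M : KripkeStructure ι κ W) :
    (modalLang ι κ).Structure W where
  funMap := fun f _ => Empty.elim f
  RelMap := fun r x =>
    match r, x with
    | ModalRel.pred j, x => M.P j (x 0)
    | ModalRel.acc i, x => M.E i (x 0) (x 1)

/-- First-order formulae `φ(x)` in a single free variable `x`, over a modal signature. -/
abbrev FOFormula (ι : Type v) (κ : Type w) := (modalLang ι κ).Formula (Fin 1)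

/-- The quantifier rank of a first-order formula. -/
def quantRank {L : FirstOrder.Language} {α : Type*} : {n : ℕ} → L.BoundedFormula α n → ℕ
  | _, .falsum => 0
  | _, .equal _ _ => 0
  | _, .rel _ _ => 0
  | _, .imp φ ψ => max (quantRank φ) (quantRank ψ)
  | _, .all φ => quantRank φ + 1

/-- `A ⊨ φ`: the formula `φ(x)` is true when `x` is the distinguished world of `A`. -/
def PointedKripke.Sat {ι : Type v} {κ : Type w} (A : PointedKripke.{u} ι κ)
    (φ : FOFormula ι κ) : Prop :=
  letI := A.str.toFO
  φ.Realize (fun _ => A.point)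

end FirstOrderLogic

section Bisimulation

variable {ι : Type v} {κ : Type w} {W W' : Type u}

/-- The worlds `a` of `M` and `a'` of `M'` satisfy the same basic propositions. -/
def AtomEquiv (M : KripkeStructure ι κ W) (M' : KripkeStructure ι κ W') (a : W) (a' : W') : Prop :=
  ∀ j, M.P j a ↔ M'.P j a'

/-- `Z` is a graded bisimulation relation between `M` and `M'`. Tuples of pairwise distinct worlds
are injective functions on `Fin k`. -/
structure IsGradedBisimulation (M : KripkeStructure ι κ W) (M' : KripkeStructure ι κ W')
    (Z : W → W' → Prop) : Prop where
  nonempty : ∃ a a', Z a a'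
  atom : ∀ a a', Z a a' → AtomEquiv M M' a a'
  forth : ∀ a a', Z a a' → ∀ (i : ι) (k : ℕ), 1 ≤ k →
    ∀ b : Fin k → W, Function.Injective b → (∀ t, M.E i a (b t)) →
      ∃ b' : Fin k → W', Function.Injective b' ∧ (∀ t, M'.E i a' (b' t)) ∧ ∀ t, Z (b t) (b' t)
  back : ∀ a a', Z a a' → ∀ (i : ι) (k : ℕ), 1 ≤ k →
    ∀ b' : Fin k → W', Function.Injective b' → (∀ t, M'.E i a' (b' t)) →
      ∃ b : Fin k → W, Function.Injective b ∧ (∀ t, M.E i a (b t)) ∧ ∀ t, Z (b t) (b' t)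

/-- The second player has a winning strategy in the `c`-graded `ℓ`-round graded bisimulation game
on `M`, `M'` from position `(a, a')`. In each round the first player picks, for some agent `i`,
a finite non-empty set of at most `c` many `i`-successors of `a` or of `a'`; the second player
answers with a set of the same size of `i`-successors on the opposite side; then the first player
picks a world in the answer, and the second player picks a world in the initial set, and the two
worlds picked form the new position. The second player loses in positions that violate atom
equivalence, and a player who cannot move loses. -/
def WinsGame (c : ℕ) (M : KripkeStructure ι κ W) (M' : KripkeStructure ι κ W') :
    ℕ → W → W' → Prop
  | 0, a, a' => AtomEquiv M M' a a'
  | ℓ + 1, a, a' => AtomEquiv M M' a a' ∧ ∀ i : ι,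
      (∀ s : Finset W, s.Nonempty → s.card ≤ c → (∀ b ∈ s, M.E i a b) →
        ∃ s' : Finset W', s'.card = s.card ∧ (∀ b' ∈ s', M'.E i a' b') ∧
          ∀ b' ∈ s', ∃ b ∈ s, WinsGame c M M' ℓ b b') ∧
      (∀ s' : Finset W', s'.Nonempty → s'.card ≤ c → (∀ b' ∈ s', M'.E i a' b') →
        ∃ s : Finset W, s.card = s'.card ∧ (∀ b ∈ s, M.E i a b) ∧
          ∀ b ∈ s, ∃ b' ∈ s', WinsGame c M M' ℓ b b')

/-- Graded bisimilarity of pointed Kripke structures. -/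
def GradedBisimilar (A B : PointedKripke.{u} ι κ) : Prop :=
  ∃ Z : A.World → B.World → Prop, IsGradedBisimulation A.str B.str Z ∧ Z A.point B.point

/-- `c`-graded `ℓ`-bisimilarity of pointed Kripke structures. -/
def CGradedBisimilar (c ℓ : ℕ) (A B : PointedKripke.{u} ι κ) : Prop :=
  WinsGame c A.str B.str ℓ A.point B.point

/-- `φ(x)` is invariant under the relation `R` over the class of all pointed Kripke structures. -/
def Invariant (R : PointedKripke.{u} ι κ → PointedKripke.{u} ι κ → Prop)
    (φ : FOFormula ι κ) : Prop :=
  ∀ A B : PointedKripke.{u} ι κ, R A B → (A.Sat φ ↔ B.Sat φ)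

/-- `φ(x)` is invariant under the relation `R` over the class of all finite pointed Kripke
structures. -/
def FinInvariant (R : PointedKripke.{u} ι κ → PointedKripke.{u} ι κ → Prop)
    (φ : FOFormula ι κ) : Prop :=
  ∀ A B : PointedKripke.{u} ι κ, Finite A.World → Finite B.World → R A B →
    (A.Sat φ ↔ B.Sat φ)

end Bisimulation

end GradedModal

/-!
The proof compares structures by Ehrenfeucht–Fraïssé games, and obtains the grade `c = q` for a
formula of quantifier rank `q`, without compactness; this is why it covers finite structures too.

*Upgrading.* Put `d = 2 ^ q - 1`. Up to graded bisimulation, a pointed structure `A` is the tree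
`unravel A d` of its paths of length at most `d`, whose leaves continue into one copy of `A`
(`gluedUnravel_gradedBisimilar`), and disjoint copies of anything may be added. If there are more
than `q` further complete copies and more than `q` further copies truncated below the leaves, then
truncating the copy of the distinguished world is invisible to formulae of quantifier rank `q`
(`sat_copies_iff`). Instead of the Gaifman distance, this locality argument uses the difference in
depth, where all of the copy of `A` has depth `d + 1`: it is a pseudometric in which accessible
worlds have distance at most `1`. So an invariant formula cannot distinguish `A` from the tree
`unravel A d`.

On the trees of `q`-graded `d`-bisimilar structures, the second player survives `q` rounds by
matching paths, closed under initial segments, with equivalent ends (`PathMatch`). A round matches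
at most one new child of each node, so that fewer than `q` children of a node are matched whenever
a new one is needed, and then the grade `q` guarantees an unmatched answer
(`PathMatch.exists_child`). Hence the formula has the same truth value in both trees
(`sat_unravel_iff`).

*Optimality.* "There is a walk of length `2 ^ q - 1` from `x`" has quantifier rank `q`, because each
quantifier halves the walk (`longWalkFormula`), and is invariant under graded bisimulation. On
directed paths with `ℓ` and with `2 ^ q - 1 > ℓ` edges it differs, but these are `c`-graded
`ℓ`-bisimilar for every `c`.
-/

namespace GradedModal

open FirstOrder FirstOrder.Language

/-! ### Back-and-forth systems -/

section BackForth

variable {ι : Type v} {κ : Type w} {W W' : Type u}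

/-- The set `S` of pairs is (the graph of) a partial isomorphism between `M` and `M'`. -/
structure IsPartialIso (M : KripkeStructure ι κ W) (M' : KripkeStructure ι κ W')
    (S : Set (W × W')) : Prop where
  eq_iff : ∀ p ∈ S, ∀ p' ∈ S, p.1 = p'.1 ↔ p.2 = p'.2
  acc_iff : ∀ p ∈ S, ∀ p' ∈ S, ∀ i, M.E i p.1 p'.1 ↔ M'.E i p.2 p'.2
  atom : ∀ p ∈ S, AtomEquiv M M' p.1 p.2

/-- The sets of pairs in `I r` are the positions from which the second player survives `r` further
rounds of the first-order Ehrenfeucht–Fraïssé game. -/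
structure IsBackForthSystem (M : KripkeStructure ι κ W) (M' : KripkeStructure ι κ W')
    (I : ℕ → Set (W × W') → Prop) : Prop where
  partialIso : ∀ r S, I r S → IsPartialIso M M' S
  forth : ∀ r S, I (r + 1) S → ∀ a, ∃ b, I r (insert (a, b) S)
  back : ∀ r S, I (r + 1) S → ∀ b, ∃ a, I r (insert (a, b) S)

theorem IsBackForthSystem.realize_iff {M : KripkeStructure ι κ W} {M' : KripkeStructure ι κ W'}
    {I : ℕ → Set (W × W') → Prop} (hI : IsBackForthSystem M M' I) {α : Type*} {n : ℕ}
    (φ : (modalLang ι κ).BoundedFormula α n) {r : ℕ} {S : Set (W × W')}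
    (hφ : quantRank φ ≤ r) (hS : I r S) {f : α → W} {f' : α → W'} (hf : ∀ x, (f x, f' x) ∈ S)
    {g : Fin n → W} {g' : Fin n → W'} (hg : ∀ k, (g k, g' k) ∈ S) :
    @BoundedFormula.Realize _ W M.toFO α n φ f g ↔
      @BoundedFormula.Realize _ W' M'.toFO α n φ f' g' := by
  let _ := M.toFO
  let _ := M'.toFO
  have hterm : ∀ {m : ℕ} {T : Set (W × W')} {h : Fin m → W} {h' : Fin m → W'},
      (∀ x, (f x, f' x) ∈ T) → (∀ k, (h k, h' k) ∈ T) →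
      ∀ t : (modalLang ι κ).Term (α ⊕ Fin m),
        (t.realize (Sum.elim f h), t.realize (Sum.elim f' h')) ∈ T := by
    intro m T h h' hf hh t
    cases t with
    | var x => cases x with
      | inl x => exact hf x
      | inr x => exact hh x
    | func s _ => exact s.elim
  induction φ generalizing r S with
  | falsum => rfl
  | equal t₁ t₂ =>
    exact (hI.partialIso r S hS).eq_iff _ (hterm hf hg t₁) _ (hterm hf hg t₂)
  | rel R ts =>
    cases R with
    | pred j => exact (hI.partialIso r S hS).atom _ (hterm hf hg (ts 0)) j
    | acc i => exact (hI.partialIso r S hS).acc_iff _ (hterm hf hg (ts 0)) _ (hterm hf hg (ts 1)) i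
  | imp φ ψ hφ' hψ' =>
    simp only [quantRank, max_le_iff] at hφ
    simp only [BoundedFormula.realize_imp]
    exact imp_congr (hφ' hφ.1 hS hf hg) (hψ' hφ.2 hS hf hg)
  | all φ ih =>
    simp only [quantRank] at hφ
    obtain ⟨r, rfl⟩ : ∃ k, r = k + 1 := ⟨r - 1, by omega⟩
    have key : ∀ a b, I r (insert (a, b) S) →
        (φ.Realize f (Fin.snoc g a) ↔ φ.Realize f' (Fin.snoc g' b)) := by
      intro a b hab
      refine ih (by omega) hab (fun x => Or.inr (hf x)) fun k => ?_
      induction k using Fin.lastCases with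
      | last => simp
      | cast k => simpa using Or.inr (hg k)
    simp only [BoundedFormula.realize_all]
    constructor
    · intro h b
      obtain ⟨a, ha⟩ := hI.back r S hS b
      exact (key a b ha).1 (h a)
    · intro h a
      obtain ⟨b, hb⟩ := hI.forth r S hS a
      exact (key a b hb).2 (h b)

theorem IsBackForthSystem.sat_iff {A B : PointedKripke.{u} ι κ}
    {I : ℕ → Set (A.World × B.World) → Prop} (hI : IsBackForthSystem A.str B.str I)
    (φ : FOFormula ι κ) (h : I (quantRank φ) {(A.point, B.point)}) : A.Sat φ ↔ B.Sat φ :=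
  hI.realize_iff φ le_rfl h (fun _ => rfl) (fun k => k.elim0)

end BackForth

/-! ### Graded bisimulations and the graded game -/

section Game

variable {ι : Type v} {κ : Type w} {W W' W'' : Type u}

/-- A bounded morphism that is bijective between the successor sets of a world and of its image
yields a graded bisimulation, namely its graph. -/
theorem GradedBisimilar.of_map {A B : PointedKripke.{u} ι κ} (f : A.World → B.World)
    (hpoint : f A.point = B.point) (hP : ∀ a, AtomEquiv A.str B.str a (f a))
    (hE : ∀ i a b, A.str.E i a b → B.str.E i (f a) (f b))
    (hinj : ∀ i a b c, A.str.E i a b → A.str.E i a c → f b = f c → b = c)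
    (hsurj : ∀ i a b', B.str.E i (f a) b' → ∃ b, A.str.E i a b ∧ f b = b') :
    GradedBisimilar A B := by
  refine ⟨fun a b => f a = b, ⟨⟨_, _, hpoint⟩, ?_, ?_, ?_⟩, hpoint⟩
  · rintro a _ rfl
    exact hP a
  · rintro a _ rfl i k - b hb hab
    exact ⟨fun t => f (b t), fun s t hst => hb (hinj i a _ _ (hab s) (hab t) hst),
      fun t => hE i a _ (hab t), fun _ => rfl⟩
  · rintro a _ rfl i k - b' hb' hab'
    choose b hb hfb using fun t => hsurj i a (b' t) (hab' t)
    exact ⟨b, fun s t hst => hb' (by rw [← hfb s, ← hfb t, hst]), hb, hfb⟩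

theorem WinsGame.atomEquiv {c n : ℕ} {M : KripkeStructure ι κ W} {M' : KripkeStructure ι κ W'}
    {a : W} {a' : W'} (h : WinsGame c M M' n a a') : AtomEquiv M M' a a' := by
  cases n with
  | zero => exact h
  | succ n => exact h.1

theorem WinsGame.symm {c n : ℕ} {M : KripkeStructure ι κ W} {M' : KripkeStructure ι κ W'}
    {a : W} {a' : W'} (h : WinsGame c M M' n a a') : WinsGame c M' M n a' a := by
  induction n generalizing a a' with
  | zero => exact fun j => (h j).symm
  | succ n ih =>
    refine ⟨fun j => (h.1 j).symm, fun i => ⟨fun s hs hc hE => ?_, fun s hs hc hE => ?_⟩⟩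
    · obtain ⟨t, ht, hE', hw⟩ := (h.2 i).2 s hs hc hE
      exact ⟨t, ht, hE', fun b hb => (hw b hb).imp fun _ hx => ⟨hx.1, ih hx.2⟩⟩
    · obtain ⟨t, ht, hE', hw⟩ := (h.2 i).1 s hs hc hE
      exact ⟨t, ht, hE', fun b hb => (hw b hb).imp fun _ hx => ⟨hx.1, ih hx.2⟩⟩

theorem WinsGame.trans {c n : ℕ} {M : KripkeStructure ι κ W} {M' : KripkeStructure ι κ W'}
    {M'' : KripkeStructure ι κ W''} {a : W} {a' : W'} {a'' : W''} (h : WinsGame c M M' n a a')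
    (h' : WinsGame c M' M'' n a' a'') : WinsGame c M M'' n a a'' := by
  induction n generalizing a a' a'' with
  | zero => exact fun j => (h j).trans (h' j)
  | succ n ih =>
    refine ⟨fun j => (h.1 j).trans (h'.1 j), fun i => ⟨fun s hs hc hE => ?_, fun s hs hc hE => ?_⟩⟩
    · obtain ⟨t, ht, htE, htw⟩ := (h.2 i).1 s hs hc hE
      obtain ⟨z, hz, hzE, hzw⟩ := (h'.2 i).1 t (Finset.card_pos.1 (ht ▸ Finset.card_pos.2 hs))
        (ht ▸ hc) htE
      refine ⟨z, hz.trans ht, hzE, fun b hb => ?_⟩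
      obtain ⟨b', hb', hw'⟩ := hzw b hb
      obtain ⟨b'', hb'', hw''⟩ := htw b' hb'
      exact ⟨b'', hb'', ih hw'' hw'⟩
    · obtain ⟨t, ht, htE, htw⟩ := (h'.2 i).2 s hs hc hE
      obtain ⟨z, hz, hzE, hzw⟩ := (h.2 i).2 t (Finset.card_pos.1 (ht ▸ Finset.card_pos.2 hs))
        (ht ▸ hc) htE
      refine ⟨z, hz.trans ht, hzE, fun b hb => ?_⟩
      obtain ⟨b', hb', hw'⟩ := hzw b hb
      obtain ⟨b'', hb'', hw''⟩ := htw b' hb'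
      exact ⟨b'', hb'', ih hw' hw''⟩

end Game

/-! ### Locality: truncating a structure at depth `2 ^ q - 1` -/

section Locality

variable {ι : Type v} {κ : Type w} {W : Type u} {J : Type}

/-- The worlds of a disjoint union, indexed by `J`, of copies of a structure whose worlds have a
`depth`: the copies with `full j` are complete, the others keep the worlds of depth less
than `d` only. -/
abbrev CopyWorld (depth : W → ℕ) (d : ℕ) (full : J → Prop) : Type u :=
  {p : J × W // full p.1 ∨ depth p.2 < d}

/-- The disjoint union of complete and of truncated copies of `M`. -/
def copies (M : KripkeStructure ι κ W) (depth : W → ℕ) (d : ℕ) (full : J → Prop) :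
    KripkeStructure ι κ (CopyWorld depth d full) where
  E i p p' := p.1.1 = p'.1.1 ∧ M.E i p.1.2 p'.1.2
  P j p := M.P j p.1.2

/-- The positions, with `r` rounds to go, of the second player's strategy between two disjoint
unions of copies of the same structure: she always answers in a copy of the world chosen by the
first player; worlds at distance at most `2 ^ r`, as far as their depths tell, belong to the same
copy on one side iff they do on the other side; and where a complete copy is matched with a
truncated one, a world is still at distance at least `2 ^ r` from the cut. -/
structure CopyMatch (depth : W → ℕ) (full full' : J → Prop) (q r : ℕ)
    (S : Set (CopyWorld depth (2 ^ q) full × CopyWorld depth (2 ^ q) full')) : Prop where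
  encard_le : S.encard + r ≤ q + 1
  snd_eq : ∀ p ∈ S, p.1.1.2 = p.2.1.2
  full_iff : ∀ p ∈ S, (full p.1.1.1 ↔ full' p.2.1.1) ∨ depth p.1.1.2 + 2 ^ r ≤ 2 ^ q
  fst_eq_iff : ∀ p ∈ S, ∀ p' ∈ S, depth p.1.1.2 ≤ depth p'.1.1.2 + 2 ^ r →
    depth p'.1.1.2 ≤ depth p.1.1.2 + 2 ^ r → (p.1.1.1 = p'.1.1.1 ↔ p.2.1.1 = p'.2.1.1)

theorem CopyMatch.swap {depth : W → ℕ} {full full' : J → Prop} {q r : ℕ}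
    {S : Set (CopyWorld depth (2 ^ q) full × CopyWorld depth (2 ^ q) full')}
    (h : CopyMatch depth full full' q r S) :
    CopyMatch depth full' full q r (Prod.swap ⁻¹' S) where
  encard_le := by
    rw [← Set.image_swap_eq_preimage_swap, Prod.swap_injective.encard_image]
    exact h.encard_le
  snd_eq p hp := (h.snd_eq _ hp).symm
  full_iff p hp := by
    have := h.full_iff _ hp
    have e := h.snd_eq _ hp
    simp only [Prod.fst_swap, Prod.snd_swap] at this e
    rw [← e]
    exact this.imp_left Iff.symm
  fst_eq_iff p hp p' hp' h₁ h₂ := by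
    have e := h.snd_eq _ hp
    have e' := h.snd_eq _ hp'
    simp only [Prod.fst_swap, Prod.snd_swap] at e e'
    rw [← e, ← e'] at h₁ h₂
    exact (h.fst_eq_iff _ hp _ hp' h₁ h₂).symm

theorem CopyMatch.forth {depth : W → ℕ} {full full' : J → Prop} {q r : ℕ}
    {S : Set (CopyWorld depth (2 ^ q) full × CopyWorld depth (2 ^ q) full')}
    (hfresh : ∀ j, ∀ s : Set J, s.encard ≤ q → ∃ j' ∉ s, (full j ↔ full' j'))
    (h : CopyMatch depth full full' q (r + 1) S) (a : CopyWorld depth (2 ^ q) full) :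
    ∃ b, CopyMatch depth full full' q r (insert (a, b) S) := by
  have hpow : 2 ^ (r + 1) = 2 ^ r + 2 ^ r := by ring
  have hpos := Nat.two_pow_pos r
  have hcard : ∀ p, (insert p S).encard + r ≤ q + 1 := fun p =>
    calc (insert p S).encard + r ≤ (S.encard + 1) + r := by gcongr; exact Set.encard_insert_le _ _
      _ = S.encard + ((r + 1 : ℕ) : ℕ∞) := by push_cast; ring
      _ ≤ q + 1 := h.encard_le
  -- It suffices to find an answer that is correct relative to the previous positions.
  suffices ∃ j', ∃ hj : full' j' ∨ depth a.1.2 < 2 ^ q,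
      ((full a.1.1 ↔ full' j') ∨ depth a.1.2 + 2 ^ r ≤ 2 ^ q) ∧
      ∀ p ∈ S, depth a.1.2 ≤ depth p.1.1.2 + 2 ^ r → depth p.1.1.2 ≤ depth a.1.2 + 2 ^ r →
        (a.1.1 = p.1.1.1 ↔ j' = p.2.1.1) by
    obtain ⟨j', hj, hfull, hS⟩ := this
    refine ⟨⟨(j', a.1.2), hj⟩, hcard _, ?_, ?_, ?_⟩
    · rintro p (rfl | hp)
      · rfl
      · exact h.snd_eq p hp
    · rintro p (rfl | hp)
      · exact hfull
      · exact (h.full_iff p hp).imp_right fun h' => by omega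
    · rintro p (rfl | hp) p' (rfl | hp') h₁ h₂
      · simp
      · exact hS p' hp' h₁ h₂
      · rw [eq_comm, hS p hp h₂ h₁, eq_comm]
      · exact h.fst_eq_iff p hp p' hp' (by omega) (by omega)
  -- A world within distance `2 ^ r` of an earlier one is answered in the copy matched with it.
  -- The bounds for `r + 1` and the triangle inequality show that this is consistent.
  by_cases hnear : ∃ p ∈ S, a.1.1 = p.1.1.1 ∧ depth a.1.2 ≤ depth p.1.1.2 + 2 ^ r ∧
      depth p.1.1.2 ≤ depth a.1.2 + 2 ^ r
  · obtain ⟨p, hp, hj, h₁, h₂⟩ := hnear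
    have hfull : (full a.1.1 ↔ full' p.2.1.1) ∨ depth a.1.2 + 2 ^ r ≤ 2 ^ q := by
      rw [hj]
      refine (h.full_iff p hp).imp_right fun h' => ?_
      omega
    refine ⟨p.2.1.1, ?_, hfull, fun p' hp' h₃ h₄ => ?_⟩
    · rcases hfull with hfull | hfull
      · rw [← hfull]
        exact a.2
      · exact Or.inr (by omega)
    · rw [hj]
      exact h.fst_eq_iff p hp p' hp' (by omega) (by omega)
  -- Any other world is answered in an unused copy of the same kind.
  · obtain ⟨j', hj', hfull⟩ := hfresh a.1.1 ((fun p => p.2.1.1) '' S) <| by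
      have h₁ : S.encard + 1 ≤ q + 1 := le_trans (by gcongr; simp) h.encard_le
      exact (Set.encard_image_le _ _).trans ((ENat.add_le_add_iff_right (by simp)).1 h₁)
    refine ⟨j', ?_, Or.inl hfull, fun p hp h₁ h₂ => ?_⟩
    · rw [← hfull]
      exact a.2
    · refine iff_of_false (fun e => hnear ⟨p, hp, e, h₁, h₂⟩) fun e => hj' ⟨p, hp, e.symm⟩

/-- If accessible worlds differ in depth by at most `1`, then first-order formulae of quantifier
rank `q` cannot tell a complete copy from a copy truncated at depth `2 ^ q`, in the presence of
sufficiently many further copies of either kind. -/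
theorem sat_copies_iff (M : KripkeStructure ι κ W) (depth : W → ℕ) (full full' : J → Prop)
    (φ : FOFormula ι κ) (hE : ∀ i a b, M.E i a b → depth a ≤ depth b + 1 ∧ depth b ≤ depth a + 1)
    (hfresh : ∀ j, ∀ s : Set J, s.encard ≤ quantRank φ → ∃ j' ∉ s, (full j ↔ full' j'))
    (hfresh' : ∀ j, ∀ s : Set J, s.encard ≤ quantRank φ → ∃ j' ∉ s, (full' j ↔ full j'))
    {d : ℕ} (hd : d = 2 ^ quantRank φ) (j : J) (m : W) (hm : depth m = 0)
    (h : full j ∨ depth m < d) (h' : full' j ∨ depth m < d) :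
    PointedKripke.Sat ⟨_, copies M depth d full, ⟨(j, m), h⟩⟩ φ ↔
      PointedKripke.Sat ⟨_, copies M depth d full', ⟨(j, m), h'⟩⟩ φ := by
  subst hd
  refine IsBackForthSystem.sat_iff (I := CopyMatch depth full full' (quantRank φ)) ⟨?_, ?_, ?_⟩ φ ?_
  · intro r S h
    have hr := Nat.one_le_two_pow (n := r)
    refine ⟨fun p hp p' hp' => ?_, fun p hp p' hp' i => ?_, fun p hp k => ?_⟩
    · have e := h.snd_eq p hp
      have e' := h.snd_eq p' hp'
      have hj := h.fst_eq_iff p hp p' hp'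
      simp only [Subtype.ext_iff, Prod.ext_iff, ← e, ← e']
      refine and_congr_left fun he => hj ?_ ?_ <;> rw [he] <;> omega
    · have e := h.snd_eq p hp
      have e' := h.snd_eq p' hp'
      have hj := h.fst_eq_iff p hp p' hp'
      simp only [copies, ← e, ← e']
      refine and_congr_left fun he => ?_
      have := hE _ _ _ he
      exact hj (by omega) (by omega)
    · simp only [copies, h.snd_eq p hp]
  · exact fun r S h a => h.forth hfresh a
  · intro r S h b
    obtain ⟨a, ha⟩ := h.swap.forth hfresh' b
    refine ⟨a, ?_⟩
    have := ha.swap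
    convert this using 1
    ext ⟨x, y⟩
    simp [Prod.ext_iff, and_comm]
  · refine ⟨by simp [add_comm], ?_, ?_, ?_⟩
    · rintro p rfl
      rfl
    · rintro p rfl
      simp [hm]
    · rintro p rfl p' rfl - -
      simp

end Locality

/-! ### Tree unravellings of finite depth -/

section Unravelling

variable {ι : Type v} {κ : Type w} {W W' : Type u} {Λ : Type}

/-- The last world on a path that starts from `w`. Paths are lists of steps, the latest step first;
a step consists of the label of an agent and of the world it leads to. -/
def pathEnd (w : W) : List (Λ × W) → W
  | [] => w
  | a :: _ => a.2

/-- The list is a path in `M` that starts from `w`, where agents are labelled by `e`. -/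
def IsPath (M : KripkeStructure ι κ W) (e : ι ≃ Λ) (w : W) : List (Λ × W) → Prop
  | [] => True
  | a :: x => IsPath M e w x ∧ M.E (e.symm a.1) (pathEnd w x) a.2

/-- The paths in `M` of length at most `d` from `w`. -/
abbrev PathWorld (M : KripkeStructure ι κ W) (e : ι ≃ Λ) (w : W) (d : ℕ) : Type u :=
  {x : List (Λ × W) // IsPath M e w x ∧ x.length ≤ d}

/-- The path of length `0`. -/
def rootPath (M : KripkeStructure ι κ W) (e : ι ≃ Λ) (w : W) (d : ℕ) : PathWorld M e w d :=
  ⟨[], trivial, d.zero_le⟩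

/-- The tree unravelling of `M` from `w`, truncated at depth `d`. -/
def unravel (M : KripkeStructure ι κ W) (e : ι ≃ Λ) (w : W) (d : ℕ) :
    KripkeStructure ι κ (PathWorld M e w d) where
  E i x y := ∃ v, y.1 = (e i, v) :: x.1
  P j x := M.P j (pathEnd w x.1)

/-- The tree unravelling of `M` from `w` up to depth `d`, continued by `M` itself: the leaves at
depth `d` have their successors in one common copy of `M`. For finite `M` this is finite. -/
def gluedUnravel (M : KripkeStructure ι κ W) (e : ι ≃ Λ) (w : W) (d : ℕ) :
    KripkeStructure ι κ (PathWorld M e w d ⊕ W) where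
  E i
    | .inl x, .inl y => (unravel M e w d).E i x y
    | .inl x, .inr v => x.1.length = d ∧ M.E i (pathEnd w x.1) v
    | .inr _, .inl _ => False
    | .inr u, .inr v => M.E i u v
  P j
    | .inl x => M.P j (pathEnd w x.1)
    | .inr v => M.P j v

/-- The depth of a world in `gluedUnravel`, where the whole copy of `M` is placed just below the
leaves of the tree. -/
def gluedDepth {M : KripkeStructure ι κ W} {e : ι ≃ Λ} {w : W} {d : ℕ} :
    PathWorld M e w d ⊕ W → ℕ
  | .inl x => x.1.length
  | .inr _ => d + 1

theorem finite_pathWorld [Finite W] [Finite Λ] (M : KripkeStructure ι κ W) (e : ι ≃ Λ) (w : W)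
    (d : ℕ) : Finite (PathWorld M e w d) :=
  Set.Finite.subset (List.finite_length_le (Λ × W) d) fun _ h => h.2

theorem gluedDepth_le_of_acc {M : KripkeStructure ι κ W} {e : ι ≃ Λ} {w : W} {d : ℕ} {i : ι}
    {a b : PathWorld M e w d ⊕ W} (h : (gluedUnravel M e w d).E i a b) :
    gluedDepth a ≤ gluedDepth b + 1 ∧ gluedDepth b ≤ gluedDepth a + 1 := by
  rcases a with x | u <;> rcases b with y | v
  · obtain ⟨v, hv⟩ := h
    simp [gluedDepth, hv]
    omega
  · obtain ⟨hx, -⟩ := h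
    simp only [gluedDepth, hx]
    omega
  · exact h.elim
  · simp [gluedDepth]

theorem gluedUnravel_gradedBisimilar (A : PointedKripke.{u} ι κ) (e : ι ≃ Λ) (d : ℕ) :
    GradedBisimilar ⟨_, gluedUnravel A.str e A.point d, .inl (rootPath _ _ _ _)⟩ A := by
  refine GradedBisimilar.of_map (Sum.elim (fun x => pathEnd A.point x.1) id) rfl ?_ ?_ ?_ ?_
  · rintro (x | u) j <;> rfl
  · rintro i (x | u) (y | v) h
    · obtain ⟨v, hv⟩ := h
      have := y.2.1
      rw [hv] at this
      simpa [hv, IsPath, pathEnd] using this.2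
    · exact h.2
    · exact h.elim
    · exact h
  · rintro i (x | u) (y | v) (z | t) h h' heq
    · obtain ⟨v, hv⟩ := h
      obtain ⟨t, ht⟩ := h'
      have : v = t := by simpa [hv, ht, pathEnd] using heq
      exact congrArg Sum.inl (Subtype.ext (by rw [hv, ht, this]))
    · obtain ⟨v, hv⟩ := h
      have h₁ := y.2.2
      rw [hv, List.length_cons, h'.1] at h₁
      omega
    · obtain ⟨t, ht⟩ := h'
      have h₁ := z.2.2
      rw [ht, List.length_cons, h.1] at h₁
      omega
    · exact congrArg Sum.inr heq
    · exact h.elim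
    · exact h.elim
    · exact h'.elim
    · exact congrArg Sum.inr heq
  · rintro i (x | u) b' h
    · by_cases hx : x.1.length = d
      · exact ⟨.inr b', ⟨hx, h⟩, rfl⟩
      · refine ⟨.inl ⟨(e i, b') :: x.1, ⟨x.2.1, ?_⟩, ?_⟩, ⟨b', rfl⟩, rfl⟩
        · simpa using h
        · have := x.2.2
          simp only [List.length_cons]
          omega
    · exact ⟨.inr b', h, rfl⟩

/-- Truncating `gluedUnravel` leaves the tree. -/
theorem unravel_gradedBisimilar_copies {J : Type} (A : PointedKripke.{u} ι κ) (e : ι ≃ Λ)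
    {d : ℕ} {full : J → Prop} {j : J} (hj : ¬ full j)
    (h : full j ∨ gluedDepth (.inl (rootPath A.str e A.point d)) < d + 1) :
    GradedBisimilar ⟨_, unravel A.str e A.point d, rootPath _ _ _ _⟩
      ⟨_, copies (gluedUnravel A.str e A.point d) gluedDepth (d + 1) full, ⟨(j, .inl _), h⟩⟩ := by
  refine GradedBisimilar.of_map
    (fun x => ⟨(j, .inl x), Or.inr (Nat.lt_succ_of_le x.2.2)⟩) rfl ?_ ?_ ?_ ?_
  · exact fun _ _ => Iff.rfl
  · exact fun i x y hxy => ⟨rfl, hxy⟩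
  · intro i x y z _ _ heq
    simpa using heq
  · rintro i x ⟨⟨j', y | v⟩, hy⟩ ⟨rfl, hxy⟩
    · exact ⟨y, hxy, rfl⟩
    · exact absurd (hy.resolve_left hj) (by simp [gluedDepth])

theorem gluedUnravel_gradedBisimilar_copies {J : Type} (A : PointedKripke.{u} ι κ) (e : ι ≃ Λ)
    {d : ℕ} {full : J → Prop} {j : J} (hj : full j)
    (h : full j ∨ gluedDepth (.inl (rootPath A.str e A.point d)) < d + 1) :
    GradedBisimilar ⟨_, gluedUnravel A.str e A.point d, .inl (rootPath _ _ _ _)⟩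
      ⟨_, copies (gluedUnravel A.str e A.point d) gluedDepth (d + 1) full, ⟨(j, .inl _), h⟩⟩ := by
  refine GradedBisimilar.of_map (fun x => ⟨(j, x), Or.inl hj⟩) rfl ?_ ?_ ?_ ?_
  · exact fun _ _ => Iff.rfl
  · exact fun i x y hxy => ⟨rfl, hxy⟩
  · intro i x y z _ _ heq
    simpa using heq
  · rintro i x ⟨⟨j', y⟩, hy⟩ ⟨rfl, hxy⟩
    exact ⟨y, hxy, rfl⟩

/-! ### The game on truncated unravellings -/

/-- `F` matches paths in `M` with paths in `M'`: it is a bijection between two sets of paths that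
are closed under initial segments, it preserves lengths, labels and initial segments, and the
second player wins the `c`-graded game from the ends of matched paths, for as many rounds as there
are levels left below in the trees truncated at depth `d`. -/
structure PathMatch (c d : ℕ) (M : KripkeStructure ι κ W) (M' : KripkeStructure ι κ W')
    (e : ι ≃ Λ) (w : W) (w' : W') (F : Set (List (Λ × W) × List (Λ × W'))) : Prop where
  root : ([], []) ∈ F
  isPath : ∀ p ∈ F, (IsPath M e w p.1 ∧ p.1.length ≤ d) ∧ IsPath M' e w' p.2 ∧ p.2.length ≤ d
  length_eq : ∀ p ∈ F, p.1.length = p.2.length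
  tail : ∀ a b x y, (a :: x, b :: y) ∈ F → a.1 = b.1 ∧ (x, y) ∈ F
  eq_iff : ∀ p ∈ F, ∀ p' ∈ F, p.1 = p'.1 ↔ p.2 = p'.2
  wins : ∀ p ∈ F, WinsGame c M M' (d - p.1.length) (pathEnd w p.1) (pathEnd w' p.2)

/-- The pairs of children of `x` and of `y` that are matched by `F`. -/
def matchedChildren (F : Set (List (Λ × W) × List (Λ × W'))) (x : List (Λ × W))
    (y : List (Λ × W')) : Set ((Λ × W) × (Λ × W')) :=
  {p | (p.1 :: x, p.2 :: y) ∈ F}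

variable {c d : ℕ} {M : KripkeStructure ι κ W} {M' : KripkeStructure ι κ W'}
  {e : ι ≃ Λ} {w : W} {w' : W'} {F : Set (List (Λ × W) × List (Λ × W'))}

theorem PathMatch.swap (h : PathMatch c d M M' e w w' F) :
    PathMatch c d M' M e w' w (Prod.swap ⁻¹' F) where
  root := h.root
  isPath p hp := (h.isPath _ hp).symm
  length_eq p hp := (h.length_eq _ hp).symm
  tail a b x y hp := let h' := h.tail b a y x hp; ⟨h'.1.symm, h'.2⟩
  eq_iff p hp p' hp' := (h.eq_iff _ hp _ hp').symm
  wins p hp := by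
    have h' := (h.wins _ hp).symm
    rwa [h.length_eq _ hp] at h'

theorem encard_matchedChildren_swap (x : List (Λ × W)) (y : List (Λ × W')) :
    (matchedChildren (Prod.swap ⁻¹' F) y x).encard = (matchedChildren F x y).encard := by
  rw [← Prod.swap_injective.encard_image (matchedChildren F x y), Set.image_swap_eq_preimage_swap]
  rfl

/-- The step at which the grade `c` is used: if fewer than `c` children of `x` are matched, then a
further child of `x` can be matched with a new child of `y`. The first player proposes this child
together with all matched children that are equivalent to it; the second player's answer has more
worlds than are matched so far. -/
theorem PathMatch.exists_child (h : PathMatch c d M M' e w w' F) {k : ℕ} (hk : k < c)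
    {x : List (Λ × W)} {y : List (Λ × W')} (hxy : (x, y) ∈ F)
    (hcard : (matchedChildren F x y).encard ≤ k) {a : Λ × W} (ha : IsPath M e w (a :: x))
    (hlen : (a :: x).length ≤ d) (hnew : ∀ z, (a :: x, z) ∉ F) :
    ∃ v' : W', M'.E (e.symm a.1) (pathEnd w' y) v' ∧
      WinsGame c M M' (d - (a :: x).length) a.2 v' ∧ ∀ z, (z, (a.1, v') :: y) ∉ F := by
  classical
  set n := d - (a :: x).length with hn
  have hfin : (matchedChildren F x y).Finite :=
    Set.finite_of_encard_le_coe hcard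
  set C := hfin.toFinset with hC
  have hmem : ∀ p, p ∈ C ↔ (p.1 :: x, p.2 :: y) ∈ F := fun p => by simp [hC, matchedChildren]
  have hCcard : C.card ≤ k := by
    rw [hfin.encard_eq_coe_toFinset_card] at hcard
    exact_mod_cast hcard
  set D := C.filter fun p => p.1.1 = a.1 ∧ WinsGame c M M n p.1.2 a.2 with hD
  have hDcard : D.card ≤ k := (Finset.card_filter_le _ _).trans hCcard
  have hDinj : Set.InjOn (fun p : (Λ × W) × (Λ × W') => p.1.2) D := by
    intro p hp p' hp' heq
    simp only [hD, Finset.coe_filter, Set.mem_ofPred_eq, hmem] at hp hp'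
    have h₁ : p.1 = p'.1 := Prod.ext (hp.2.1.trans hp'.2.1.symm) heq
    have h₂ := (h.eq_iff _ hp.1 _ hp'.1).1 (by simp [h₁])
    exact Prod.ext h₁ (List.cons.inj h₂).1
  have hanot : a.2 ∉ D.image fun p => p.1.2 := by
    simp only [Finset.mem_image, not_exists, not_and]
    intro p hp heq
    simp only [hD, Finset.mem_filter, hmem] at hp
    have : p.1 = a := Prod.ext hp.2.1 heq
    exact hnew (p.2 :: y) (this ▸ hp.1)
  -- The set proposed by the first player.
  set s := insert a.2 (D.image fun p => p.1.2) with hs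
  have hscard : s.card = D.card + 1 := by
    rw [hs, Finset.card_insert_of_notMem hanot, Finset.card_image_of_injOn hDinj]
  have hwin := h.wins _ hxy
  have hlen' : d - x.length = n + 1 := by
    rw [List.length_cons] at hn hlen
    omega
  simp only [hlen'] at hwin
  obtain ⟨s', hs'card, hs'E, hs'w⟩ := (hwin.2 (e.symm a.1)).1 s ⟨a.2, by simp [hs]⟩ (by omega) <| by
    intro b hb
    rw [hs, Finset.mem_insert] at hb
    rcases hb with rfl | hb
    · exact ha.2
    · obtain ⟨p, hp, rfl⟩ := Finset.mem_image.1 hb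
      simp only [hD, Finset.mem_filter, hmem] at hp
      rw [← hp.2.1]
      exact (h.isPath _ hp.1).1.1.2
  have hs'a : ∀ b' ∈ s', WinsGame c M M' n a.2 b' := by
    intro b' hb'
    obtain ⟨b, hb, hbb'⟩ := hs'w b' hb'
    rw [hs, Finset.mem_insert] at hb
    rcases hb with rfl | hb
    · exact hbb'
    · obtain ⟨p, hp, rfl⟩ := Finset.mem_image.1 hb
      simp only [hD, Finset.mem_filter, hmem] at hp
      exact hp.2.2.symm.trans hbb'
  obtain ⟨v', hv', hv'new⟩ := Finset.exists_mem_notMem_of_card_lt_card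
    (s := D.image fun p => p.2.2) (t := s')
    (Finset.card_image_le.trans_lt (by omega))
  refine ⟨v', hs'E v' hv', hs'a v' hv', fun z hz => hv'new ?_⟩
  cases z with
  | nil => simpa using h.length_eq _ hz
  | cons b z =>
    obtain ⟨hb, hzy⟩ := h.tail _ _ _ _ hz
    obtain rfl : z = x := (h.eq_iff _ hzy _ hxy).2 rfl
    refine Finset.mem_image.2 ⟨(b, (a.1, v')), ?_, rfl⟩
    simp only [hD, Finset.mem_filter, hmem]
    refine ⟨hz, hb, ?_⟩
    have hb' := h.wins _ hz
    have hbn : d - (b :: z).length = n := by simp [hn]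
    simp only [hbn] at hb'
    exact hb'.trans (hs'a v' hv').symm

/-- A further path can be matched at the cost of at most one new child for every node. -/
theorem PathMatch.exists_extend (h : PathMatch c d M M' e w w' F) {k : ℕ} (hk : k < c)
    (hcard : ∀ x y, (matchedChildren F x y).encard ≤ k) (x : List (Λ × W))
    (hx : IsPath M e w x) (hlen : x.length ≤ d) :
    ∃ y F', PathMatch c d M M' e w w' F' ∧ F ⊆ F' ∧ (x, y) ∈ F' ∧
      ∀ p ∈ F', p ∈ F ∨ p.1 <:+ x ∧ p.2 <:+ y := by
  induction x with
  | nil => exact ⟨[], F, h, subset_rfl, h.root, fun p hp => Or.inl hp⟩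
  | cons a x ih =>
    obtain ⟨y, F₀, h₀, hF₀, hxy, hnew⟩ := ih hx.1 (by simp at hlen; omega)
    by_cases hex : ∃ z, (a :: x, z) ∈ F₀
    · obtain ⟨z, hz⟩ := hex
      refine ⟨z, F₀, h₀, hF₀, hz, fun p hp => (hnew p hp).imp_right fun hp' => ?_⟩
      cases z with
      | nil => simpa using h₀.length_eq _ hz
      | cons b z =>
        obtain rfl : z = y := (h₀.eq_iff _ (h₀.tail _ _ _ _ hz).2 _ hxy).1 rfl
        exact ⟨hp'.1.trans (List.suffix_cons _ _), hp'.2.trans (List.suffix_cons _ _)⟩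
    · push Not at hex
      have hsub : matchedChildren F₀ x y ⊆ matchedChildren F x y := by
        intro p hp
        refine (hnew _ hp).resolve_right fun hp' => ?_
        have := hp'.1.length_le
        simp at this
      obtain ⟨v', hE, hwin, hv'⟩ :=
        h₀.exists_child hk hxy ((Set.encard_le_encard hsub).trans (hcard x y)) hx hlen hex
      have hxylen : x.length = y.length := h₀.length_eq _ hxy
      refine ⟨(a.1, v') :: y, insert (a :: x, (a.1, v') :: y) F₀, ⟨?_, ?_, ?_, ?_, ?_, ?_⟩,
        hF₀.trans (Set.subset_insert _ _), Set.mem_insert _ _, ?_⟩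
      · exact Or.inr h₀.root
      · rintro p (rfl | hp)
        · refine ⟨⟨hx, hlen⟩, ⟨(h₀.isPath _ hxy).2.1, hE⟩, ?_⟩
          simpa [← hxylen] using hlen
        · exact h₀.isPath p hp
      · rintro p (rfl | hp)
        · simpa using hxylen
        · exact h₀.length_eq p hp
      · rintro a' b' x' y' (heq | hp)
        · simp only [Prod.mk.injEq, List.cons.injEq] at heq
          obtain ⟨⟨rfl, rfl⟩, rfl, rfl⟩ := heq
          exact ⟨rfl, Or.inr hxy⟩
        · exact (h₀.tail _ _ _ _ hp).imp_right Or.inr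
      · rintro p (rfl | hp) p' (rfl | hp')
        · simp
        · exact iff_of_false (fun heq : a :: x = p'.1 => hex p'.2 (heq ▸ hp'))
            fun heq : (a.1, v') :: y = p'.2 => hv' p'.1 (heq ▸ hp')
        · exact iff_of_false (fun heq : p.1 = a :: x => hex p.2 (heq ▸ hp))
            fun heq : p.2 = (a.1, v') :: y => hv' p.1 (heq ▸ hp)
        · exact h₀.eq_iff p hp p' hp'
      · rintro p (rfl | hp)
        · exact hwin
        · exact h₀.wins p hp
      · rintro p (rfl | hp)
        · exact Or.inr ⟨List.suffix_rfl, List.suffix_rfl⟩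
        · exact (hnew p hp).imp_right fun hp' =>
            ⟨hp'.1.trans (List.suffix_cons _ _), hp'.2.trans (List.suffix_cons _ _)⟩

theorem PathMatch.exists_extend_encard_le (h : PathMatch c d M M' e w w' F) {k : ℕ} (hk : k < c)
    (hcard : ∀ x y, (matchedChildren F x y).encard ≤ k) (x : PathWorld M e w d) :
    ∃ (y : PathWorld M' e w' d) (F' : _), PathMatch c d M M' e w w' F' ∧ F ⊆ F' ∧
      (x.1, y.1) ∈ F' ∧ ∀ x y, (matchedChildren F' x y).encard ≤ k + 1 := by
  obtain ⟨y, F', h', hF, hxy, hnew⟩ := h.exists_extend hk hcard x.1 x.2.1 x.2.2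
  refine ⟨⟨y, (h'.isPath _ hxy).2⟩, F', h', hF, hxy, fun u u' => ?_⟩
  have hsub : matchedChildren F' u u' ⊆
      matchedChildren F u u' ∪ {p | p.1 :: u <:+ x.1 ∧ p.2 :: u' <:+ y} := fun p hp => hnew _ hp
  have hone : {p : (Λ × W) × (Λ × W') | p.1 :: u <:+ x.1 ∧ p.2 :: u' <:+ y}.encard ≤ 1 := by
    rw [Set.encard_le_one_iff]
    rintro p p' ⟨h₁, h₂⟩ ⟨h₁', h₂'⟩
    have e₁ := List.suffix_of_suffix_length_le h₁ h₁' (by simp)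
    have e₂ := List.suffix_of_suffix_length_le h₂ h₂' (by simp)
    exact Prod.ext (List.cons.inj (e₁.eq_of_length (by simp))).1
      (List.cons.inj (e₂.eq_of_length (by simp))).1
  calc (matchedChildren F' u u').encard
      ≤ (matchedChildren F u u').encard +
        {p : (Λ × W) × (Λ × W') | p.1 :: u <:+ x.1 ∧ p.2 :: u' <:+ y}.encard :=
        (Set.encard_le_encard hsub).trans (Set.encard_union_le _ _)
    _ ≤ k + 1 := add_le_add (hcard u u') hone

/-- The positions, with `r` of `q` rounds to go, of the second player's strategy on truncated
unravellings. -/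
def UnravelMatch (q d : ℕ) (M : KripkeStructure ι κ W) (M' : KripkeStructure ι κ W') (e : ι ≃ Λ)
    (w : W) (w' : W') (r : ℕ) (S : Set (PathWorld M e w d × PathWorld M' e w' d)) : Prop :=
  ∃ F k, k + r ≤ q ∧ PathMatch q d M M' e w w' F ∧
    (∀ x y, (matchedChildren F x y).encard ≤ k) ∧ ∀ p ∈ S, (p.1.1, p.2.1) ∈ F

theorem isBackForthSystem_unravelMatch (q d : ℕ) (M : KripkeStructure ι κ W)
    (M' : KripkeStructure ι κ W') (e : ι ≃ Λ) (w : W) (w' : W') :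
    IsBackForthSystem (unravel M e w d) (unravel M' e w' d) (UnravelMatch q d M M' e w w') := by
  refine ⟨?_, ?_, ?_⟩
  · rintro r S ⟨F, k, -, h, -, hS⟩
    refine ⟨fun p hp p' hp' => ?_, fun p hp p' hp' i => ?_, fun p hp j => ?_⟩
    · rw [Subtype.ext_iff, Subtype.ext_iff]
      exact h.eq_iff _ (hS p hp) _ (hS p' hp')
    · constructor
      · rintro ⟨v, hv⟩
        have hp₁ := hS p' hp'
        rw [hv] at hp₁
        rcases hy : p'.2.1 with _ | ⟨b, y⟩
        · rw [hy] at hp₁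
          simpa using h.length_eq _ hp₁
        · rw [hy] at hp₁
          obtain ⟨hb, hp₂⟩ := h.tail _ _ _ _ hp₁
          have : y = p.2.1 := (h.eq_iff _ hp₂ _ (hS p hp)).1 rfl
          exact ⟨b.2, by rw [hy, this, show e i = b.1 from hb]⟩
      · rintro ⟨v, hv⟩
        have hp₁ := hS p' hp'
        rw [hv] at hp₁
        rcases hy : p'.1.1 with _ | ⟨b, y⟩
        · rw [hy] at hp₁
          simpa using h.length_eq _ hp₁
        · rw [hy] at hp₁
          obtain ⟨hb, hp₂⟩ := h.tail _ _ _ _ hp₁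
          have : y = p.1.1 := (h.eq_iff _ hp₂ _ (hS p hp)).2 rfl
          exact ⟨b.2, by rw [hy, this, show e i = b.1 from hb.symm]⟩
    · exact (h.wins _ (hS p hp)).atomEquiv j
  · rintro r S ⟨F, k, hk, h, hcard, hS⟩ a
    obtain ⟨b, F', h', hF, hab, hcard'⟩ := h.exists_extend_encard_le (by omega) hcard a
    refine ⟨b, F', k + 1, by omega, h', by exact_mod_cast hcard', ?_⟩
    rintro p (rfl | hp)
    · exact hab
    · exact hF (hS p hp)
  · rintro r S ⟨F, k, hk, h, hcard, hS⟩ b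
    obtain ⟨a, F', h', hF, hab, hcard'⟩ := h.swap.exists_extend_encard_le (k := k) (by omega)
      (fun x y => (encard_matchedChildren_swap y x).trans_le (hcard y x)) b
    refine ⟨a, Prod.swap ⁻¹' F', k + 1, by omega, h'.swap,
      fun x y => (encard_matchedChildren_swap y x).trans_le (by exact_mod_cast hcard' y x), ?_⟩
    rintro p (rfl | hp)
    · exact hab
    · exact hF (hS p hp)

/-- First-order formulae of quantifier rank `q` cannot tell the truncated tree unravellings of
`q`-graded `d`-bisimilar structures. -/
theorem sat_unravel_iff (φ : FOFormula ι κ) (d : ℕ) (e : ι ≃ Λ) {A B : PointedKripke.{u} ι κ}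
    (h : CGradedBisimilar (quantRank φ) d A B) :
    PointedKripke.Sat ⟨_, unravel A.str e A.point d, rootPath _ _ _ _⟩ φ ↔
      PointedKripke.Sat ⟨_, unravel B.str e B.point d, rootPath _ _ _ _⟩ φ := by
  refine IsBackForthSystem.sat_iff
    (isBackForthSystem_unravelMatch (quantRank φ) d A.str B.str e A.point B.point) φ
    ⟨{([], [])}, 0, by simp, ⟨rfl, ?_, ?_, ?_, ?_, ?_⟩, ?_, ?_⟩
  · rintro p rfl
    exact ⟨⟨trivial, d.zero_le⟩, trivial, d.zero_le⟩
  · rintro p rfl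
    rfl
  · intro a b x y hp
    simp at hp
  · rintro p rfl p' rfl
    simp
  · rintro p rfl
    exact h
  · simp [matchedChildren]
  · rintro p rfl
    rfl

end Unravelling

/-! ### Upgrading -/

section Upgrading

variable {ι : Type v} {κ : Type w}

/-- The index set of the copies used in the proof of locality: the copy `none` of the distinguished
world, and `q + 1` further copies of either kind. -/
abbrev CopyIndex (q : ℕ) : Type := Option (Bool × Fin (q + 1))

theorem CopyIndex.exists_fresh {q : ℕ} (full full' : CopyIndex q → Prop)
    (h : ∀ b k, full' (some (b, k)) ↔ b = true) (j : CopyIndex q) (s : Set (CopyIndex q))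
    (hs : s.encard ≤ q) : ∃ j' ∉ s, (full j ↔ full' j') := by
  classical
  by_contra hcon
  have hsub : Set.range (fun k : Fin (q + 1) => (some (decide (full j), k) : CopyIndex q)) ⊆ s := by
    rintro _ ⟨k, rfl⟩
    by_contra hk
    exact hcon ⟨_, hk, by simp [h]⟩
  have hinj : Function.Injective
      (fun k : Fin (q + 1) => (some (decide (full j), k) : CopyIndex q)) :=
    fun k l hkl => by simpa using hkl
  have h₁ := (Set.encard_le_encard hsub).trans hs
  rw [← Set.image_univ, hinj.encard_image, Set.encard_univ] at h₁
  simp only [ENat.card_eq_coe_fintype_card, Fintype.card_fin] at h₁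
  have : q + 1 ≤ q := by exact_mod_cast h₁
  omega

/-- The upgrading argument, over the class of all structures if `fin` is false and over the class
of finite structures if `fin` is true. -/
theorem sat_iff_of_cGradedBisimilar [Finite ι] (φ : FOFormula ι κ) (fin : Prop)
    (hφ : ∀ A B : PointedKripke.{u} ι κ, (fin → Finite A.World) → (fin → Finite B.World) →
      GradedBisimilar A B → (A.Sat φ ↔ B.Sat φ))
    (A B : PointedKripke.{u} ι κ) (hA : fin → Finite A.World) (hB : fin → Finite B.World)
    (h : CGradedBisimilar (quantRank φ) (2 ^ quantRank φ - 1) A B) : A.Sat φ ↔ B.Sat φ := by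
  obtain ⟨n, ⟨e⟩⟩ := Finite.exists_equiv_fin ι
  set q := quantRank φ
  obtain ⟨d, hd⟩ : ∃ d, 2 ^ q = d + 1 := ⟨2 ^ q - 1, by have := Nat.one_le_two_pow (n := q); omega⟩
  rw [hd, Nat.add_sub_cancel] at h
  -- A structure and its truncated unravelling agree on `φ`; only the copy `none` gets truncated.
  have key : ∀ C : PointedKripke.{u} ι κ, (fin → Finite C.World) → (C.Sat φ ↔
      PointedKripke.Sat ⟨_, unravel C.str e C.point d, rootPath _ _ _ _⟩ φ) := by
    intro C hC
    have hpath : fin → Finite (PathWorld C.str e C.point d) := fun hf =>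
      have := hC hf
      finite_pathWorld _ _ _ _
    have hglued : fin → Finite (PathWorld C.str e C.point d ⊕ C.World) := fun hf =>
      have := hC hf
      have := hpath hf
      inferInstance
    have hcopies : ∀ full : CopyIndex q → Prop, fin → Finite
        (CopyWorld (gluedDepth (M := C.str) (e := e) (w := C.point) (d := d)) (d + 1) full) :=
      fun full hf =>
        have := hglued hf
        inferInstance
    rw [← hφ _ _ hglued hC (gluedUnravel_gradedBisimilar C e d)]
    have hloc := sat_copies_iff (gluedUnravel C.str e C.point d) gluedDepth
      (fun j : CopyIndex q => j.elim True (·.1 = true))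
      (fun j : CopyIndex q => j.elim False (·.1 = true)) φ
      (fun i a b => gluedDepth_le_of_acc)
      (CopyIndex.exists_fresh _ _ fun _ _ => Iff.rfl)
      (CopyIndex.exists_fresh _ _ fun _ _ => Iff.rfl) hd.symm none
      (.inl (rootPath _ _ _ _)) rfl (Or.inl trivial) (Or.inr d.succ_pos)
    have hfull := hφ _ _ hglued (hcopies fun j => j.elim True (·.1 = true))
      (gluedUnravel_gradedBisimilar_copies C e
        (full := fun j : CopyIndex q => j.elim True (·.1 = true)) (j := none) trivial (Or.inl trivial))
    have htrunc := hφ _ _ hpath (hcopies fun j => j.elim False (·.1 = true))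
      (unravel_gradedBisimilar_copies C e
        (full := fun j : CopyIndex q => j.elim False (·.1 = true)) (j := none) id (Or.inr d.succ_pos))
    exact hfull.trans (hloc.trans htrunc.symm)
  rw [key A hA, key B hB]
  exact sat_unravel_iff φ d e h

end Upgrading

/-! ### Optimality: directed paths of length `2 ^ q - 1` -/

section Optimality

variable {ι : Type v} {κ : Type w} {W W' : Type u}

/-- There is a directed walk of length `n` from `a` to `b` along edges of agent `i`. -/
def Walk (M : KripkeStructure ι κ W) (i : ι) : ℕ → W → W → Prop
  | 0, a, b => a = b
  | n + 1, a, b => ∃ c, M.E i a c ∧ Walk M i n c b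

theorem walk_add (M : KripkeStructure ι κ W) (i : ι) (m n : ℕ) (a b : W) :
    Walk M i (m + n) a b ↔ ∃ c, Walk M i m a c ∧ Walk M i n c b := by
  induction m generalizing a with
  | zero => simp [Walk]
  | succ m ih =>
    rw [Nat.succ_add]
    simp only [Walk, ih]
    tauto

theorem IsGradedBisimulation.exists_walk {M : KripkeStructure ι κ W} {M' : KripkeStructure ι κ W'}
    {Z : W → W' → Prop} (hZ : IsGradedBisimulation M M' Z) {i : ι} {n : ℕ} {a b : W} {a' : W'}
    (ha : Z a a') (h : Walk M i n a b) : ∃ b', Walk M' i n a' b' := by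
  induction n generalizing a a' with
  | zero => exact ⟨a', rfl⟩
  | succ n ih =>
    obtain ⟨c, hac, hcb⟩ := h
    obtain ⟨c', -, hc', hcc'⟩ := hZ.forth a a' ha i 1 le_rfl (fun _ => c)
      (Function.injective_of_subsingleton _) (fun _ => hac)
    obtain ⟨b', hb'⟩ := ih (hcc' 0) hcb
    exact ⟨b', c' 0, hc' 0, hb'⟩

theorem IsGradedBisimulation.symm {M : KripkeStructure ι κ W} {M' : KripkeStructure ι κ W'}
    {Z : W → W' → Prop} (hZ : IsGradedBisimulation M M' Z) :
    IsGradedBisimulation M' M (fun a' a => Z a a') where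
  nonempty := let ⟨a, a', h⟩ := hZ.nonempty; ⟨a', a, h⟩
  atom a' a h j := (hZ.atom a a' h j).symm
  forth a' a h := hZ.back a a' h
  back a' a h := hZ.forth a a' h

/-- The formula saying that there is a walk of length `2 ^ k` from `x` to `y`, which halves the
walk at each quantifier. -/
def walkFormula (ι : Type v) (κ : Type w) (i : ι) {α : Type} :
    ℕ → {n : ℕ} → (x y : α ⊕ Fin n) → (modalLang ι κ).BoundedFormula α n
  | 0, _, x, y => .rel (ModalRel.acc i : (modalLang ι κ).Relations 2) ![.var x, .var y]
  | k + 1, n, x, y =>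
    (walkFormula ι κ i k (n := n + 1) (x.map id Fin.castSucc) (.inr (Fin.last n)) ⊓
      walkFormula ι κ i k (n := n + 1) (.inr (Fin.last n)) (y.map id Fin.castSucc)).ex

/-- The formula saying that there is a walk of length `2 ^ q - 1` that starts from `x`: its first
`2 ^ (q - 1)` steps lead to the quantified world, from where `2 ^ (q - 1) - 1` steps are left. -/
def longWalkFormula (ι : Type v) (κ : Type w) (i : ι) {α : Type} :
    ℕ → {n : ℕ} → (x : α ⊕ Fin n) → (modalLang ι κ).BoundedFormula α n
  | 0, _, _ => ⊤
  | q + 1, n, x =>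
    (walkFormula ι κ i q (n := n + 1) (x.map id Fin.castSucc) (.inr (Fin.last n)) ⊓
      longWalkFormula ι κ i q (n := n + 1) (.inr (Fin.last n))).ex

theorem quantRank_inf {L : Language} {α : Type*} {n : ℕ} (φ ψ : L.BoundedFormula α n) :
    quantRank (φ ⊓ ψ) = max (quantRank φ) (quantRank ψ) := by
  change max (max (quantRank φ) (max (quantRank ψ) 0)) 0 = _
  simp

theorem quantRank_ex {L : Language} {α : Type*} {n : ℕ} (φ : L.BoundedFormula α (n + 1)) :
    quantRank φ.ex = quantRank φ + 1 := by
  change max (max (quantRank φ) 0 + 1) 0 = _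
  simp

theorem quantRank_walkFormula (i : ι) {α : Type} (k : ℕ) {n : ℕ} (x y : α ⊕ Fin n) :
    quantRank (walkFormula ι κ i k x y) = k := by
  induction k generalizing n with
  | zero => rfl
  | succ k ih => simp [walkFormula, quantRank_ex, quantRank_inf, ih]

theorem quantRank_longWalkFormula (i : ι) {α : Type} (q : ℕ) {n : ℕ} (x : α ⊕ Fin n) :
    quantRank (longWalkFormula ι κ i q x) = q := by
  induction q generalizing n with
  | zero => rfl
  | succ k ih => simp [longWalkFormula, quantRank_ex, quantRank_inf, ih, quantRank_walkFormula]

theorem elim_snoc_map_castSucc {α : Type*} {n : ℕ} (f : α → W) (g : Fin n → W) (b : W)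
    (x : α ⊕ Fin n) :
    Sum.elim f (Fin.snoc g b : Fin (n + 1) → W) (x.map id Fin.castSucc) = Sum.elim f g x := by
  cases x <;> simp

theorem realize_walkFormula (M : KripkeStructure ι κ W) (i : ι) {α : Type} (k : ℕ) {n : ℕ}
    (x y : α ⊕ Fin n) (f : α → W) (g : Fin n → W) :
    @BoundedFormula.Realize _ W M.toFO α n (walkFormula ι κ i k x y) f g ↔
      Walk M i (2 ^ k) (Sum.elim f g x) (Sum.elim f g y) := by
  let _ := M.toFO
  induction k generalizing n with
  | zero =>
    change M.E i _ _ ↔ _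
    simp [Walk]
  | succ k ih =>
    rw [pow_succ, mul_two, walk_add]
    simp [walkFormula, ih, elim_snoc_map_castSucc]

theorem realize_longWalkFormula (M : KripkeStructure ι κ W) (i : ι) {α : Type} (q : ℕ) {n : ℕ}
    (x : α ⊕ Fin n) (f : α → W) (g : Fin n → W) :
    @BoundedFormula.Realize _ W M.toFO α n (longWalkFormula ι κ i q x) f g ↔
      ∃ b, Walk M i (2 ^ q - 1) (Sum.elim f g x) b := by
  let _ := M.toFO
  induction q generalizing n with
  | zero => simp [longWalkFormula, Walk]
  | succ q ih =>
    have e : 2 ^ (q + 1) - 1 = 2 ^ q + (2 ^ q - 1) := by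
      have := Nat.one_le_two_pow (n := q)
      rw [pow_succ]
      omega
    simp only [e, walk_add]
    rw [exists_comm]
    simp [longWalkFormula, ih, realize_walkFormula, elim_snoc_map_castSucc]

theorem sat_longWalkFormula (A : PointedKripke.{u} ι κ) (i : ι) (q : ℕ) :
    A.Sat (longWalkFormula ι κ i q (.inl 0)) ↔ ∃ b, Walk A.str i (2 ^ q - 1) A.point b :=
  realize_longWalkFormula A.str i q _ _ _

theorem invariant_longWalkFormula (i : ι) (q : ℕ) :
    Invariant.{u} GradedBisimilar (longWalkFormula ι κ i q (.inl 0)) := by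
  rintro A B ⟨Z, hZ, hAB⟩
  rw [sat_longWalkFormula, sat_longWalkFormula]
  exact ⟨fun ⟨_, h⟩ => hZ.exists_walk hAB h, fun ⟨_, h⟩ => hZ.symm.exists_walk hAB h⟩

/-- The directed path with `n` edges, with the same edges for all agents and with false basic
propositions. -/
def directedPath (ι : Type v) (κ : Type w) (n : ℕ) : KripkeStructure ι κ (ULift.{u} (Fin (n + 1)))
    where
  E _ a b := (b.down : ℕ) = a.down + 1
  P _ _ := False

/-- Directed paths are indistinguishable as long as the game reaches neither of their ends. -/
theorem winsGame_directedPath (c ℓ m n : ℕ) (a : ULift.{u} (Fin (m + 1)))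
    (b : ULift.{u} (Fin (n + 1))) (ha : a.down + ℓ ≤ m) (hb : b.down + ℓ ≤ n) :
    WinsGame c (directedPath ι κ m) (directedPath ι κ n) ℓ a b := by
  induction ℓ generalizing a b with
  | zero => exact fun _ => Iff.rfl
  | succ ℓ ih =>
    have hsub : ∀ {k : ℕ} {x : ULift.{u} (Fin (k + 1))} {s : Finset (ULift.{u} (Fin (k + 1)))},
        s.Nonempty → (∀ y ∈ s, (y.down : ℕ) = x.down + 1) → ∃ y, s = {y} := by
      intro k x s hs h
      rw [← Finset.card_eq_one]
      refine le_antisymm (Finset.card_le_one.2 fun y hy z hz => ?_) (Finset.card_pos.2 hs)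
      exact ULift.ext _ _ (Fin.ext ((h y hy).trans (h z hz).symm))
    refine ⟨fun _ => Iff.rfl, fun i => ⟨fun s hs _ hE => ?_, fun s hs _ hE => ?_⟩⟩
    · obtain ⟨y, rfl⟩ := hsub hs hE
      have hy : (y.down : ℕ) = a.down + 1 := hE y (by simp)
      refine ⟨{⟨⟨b.down + 1, by omega⟩⟩}, rfl, by simp [directedPath], fun b' hb' => ?_⟩
      rw [Finset.mem_singleton] at hb'
      subst hb'
      exact ⟨y, by simp, ih _ _ (by omega) (by simp only; omega)⟩
    · obtain ⟨y, rfl⟩ := hsub hs hE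
      have hy : (y.down : ℕ) = b.down + 1 := hE y (by simp)
      refine ⟨{⟨⟨a.down + 1, by omega⟩⟩}, rfl, by simp [directedPath], fun b' hb' => ?_⟩
      rw [Finset.mem_singleton] at hb'
      subst hb'
      exact ⟨y, by simp, ih _ _ (by simp only; omega) (by omega)⟩

theorem exists_walk_directedPath (i : ι) (n k : ℕ) (a : ULift.{u} (Fin (n + 1))) :
    (∃ b, Walk (directedPath ι κ n) i k a b) ↔ a.down + k ≤ n := by
  induction k generalizing a with
  | zero => simpa [Walk] using Nat.lt_succ_iff.1 a.down.2
  | succ k ih =>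
    simp only [Walk]
    rw [exists_comm]
    simp only [exists_and_left, ih]
    constructor
    · rintro ⟨x, hx, h⟩
      have : (x.down : ℕ) = a.down + 1 := hx
      omega
    · intro h
      exact ⟨⟨⟨a.down + 1, by omega⟩⟩, rfl, by simp only; omega⟩

theorem le_of_finInvariant_longWalkFormula (i : ι) (q c ℓ : ℕ)
    (h : FinInvariant.{u} (CGradedBisimilar c ℓ) (longWalkFormula ι κ i q (.inl 0))) :
    2 ^ q - 1 ≤ ℓ := by
  -- The maximum makes the first path at least as long as the second for every `ℓ`.
  have key := h ⟨_, directedPath ι κ (max ℓ (2 ^ q - 1)), ⟨0⟩⟩ ⟨_, directedPath ι κ ℓ, ⟨0⟩⟩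
    inferInstance inferInstance (winsGame_directedPath c ℓ _ _ _ _ (by simp) (by simp))
  simp only [sat_longWalkFormula, exists_walk_directedPath] at key
  simpa using key

end Optimality

end GradedModal

theorem mainTheorem3 (ι : Type v) (κ : Type w) [Finite ι] [Finite κ] :
    -- upgrading, over all and over all finite pointed Kripke structures
    (∀ φ : GradedModal.FOFormula ι κ,
      (GradedModal.Invariant.{u} GradedModal.GradedBisimilar φ →
        ∃ c : ℕ, GradedModal.Invariant.{u}
          (GradedModal.CGradedBisimilar c (2 ^ GradedModal.quantRank φ - 1)) φ) ∧
      (GradedModal.FinInvariant.{u} GradedModal.GradedBisimilar φ →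
        ∃ c : ℕ, GradedModal.FinInvariant.{u}
          (GradedModal.CGradedBisimilar c (2 ^ GradedModal.quantRank φ - 1)) φ)) ∧
    -- optimality of the value `2 ^ q - 1`, over all and over all finite pointed Kripke structures
    (Nonempty ι → ∀ q : ℕ,
      (∃ φ : GradedModal.FOFormula ι κ, GradedModal.quantRank φ = q ∧
        GradedModal.Invariant.{u} GradedModal.GradedBisimilar φ ∧
        ∀ c ℓ : ℕ, GradedModal.Invariant.{u} (GradedModal.CGradedBisimilar c ℓ) φ →
          2 ^ q - 1 ≤ ℓ) ∧
      (∃ φ : GradedModal.FOFormula ι κ, GradedModal.quantRank φ = q ∧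
        GradedModal.FinInvariant.{u} GradedModal.GradedBisimilar φ ∧
        ∀ c ℓ : ℕ, GradedModal.FinInvariant.{u} (GradedModal.CGradedBisimilar c ℓ) φ →
          2 ^ q - 1 ≤ ℓ)) := by
  refine ⟨fun φ => ⟨fun h => ⟨GradedModal.quantRank φ, fun A B hAB => ?_⟩,
    fun h => ⟨GradedModal.quantRank φ, fun A B hA hB hAB => ?_⟩⟩, ?_⟩
  · exact GradedModal.sat_iff_of_cGradedBisimilar φ False (fun A B _ _ => h A B) A B
      False.elim False.elim hAB
  · exact GradedModal.sat_iff_of_cGradedBisimilar φ True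
      (fun A B hA hB => h A B (hA trivial) (hB trivial)) A B (fun _ => hA) (fun _ => hB) hAB
  · rintro ⟨i⟩ q
    have hrank := GradedModal.quantRank_longWalkFormula (κ := κ) i q (.inl 0 : Fin 1 ⊕ Fin 0)
    have hinv := GradedModal.invariant_longWalkFormula.{u} (κ := κ) i q
    have hopt := GradedModal.le_of_finInvariant_longWalkFormula.{u} (κ := κ) i q
    exact ⟨⟨_, hrank, hinv, fun c ℓ h => hopt c ℓ fun A B _ _ => h A B⟩,
      ⟨_, hrank, fun A B _ _ => hinv A B, hopt⟩⟩
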